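/- Let $q$ be a prime power and let $V$ be an $\mathrm{Sp}(6,q)$-space, that is, a $6$-dimensional vector space over $K=\mathbb F_q$ with a nondegenerate alternating bilinear form. A \emph{symplectic partial spread} of $V$ is a set of totally isotropic $3$-dimensional subspaces any two of which intersect in $0$; it is a \emph{symplectic spread} if its members cover $V$, and a \emph{maximal symplectic partial spread} if it is maximal under inclusion among the symplectic partial spreads of $V$. A \emph{desarguesian spread} of $V$ is the set of all one-dimensional $F$-subspaces of $V$ for some structure on $V$ of a $2$-dimensional vector space over an extension field $F\cong\mathbb F_{q^3}$ of $K$ that extends its $K$-structure. Theorem. (i) $V$ has a maximal symplectic partial spread of size $q^3-q^2+1$. (ii) More precisely, $V$ has a symplectic spread that is desarguesian. Let $\Sigma$ be any such spread and let $X\in\Sigma$. There is a totally isotropic $3$-dimensional subspace $U$ of $V$ with $\dim (U\cap X)=2$; and for every such $U$, the set $\Sigma_U$ of members of $\Sigma$ that meet $U$ nontrivially has size $q^2+1$, and $(\Sigma\setminus\Sigma_U)\cup\{U\}$ is a maximal symplectic partial spread of size $q^3-q^2+1$. -/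

import Mathlib

universe u v

section SymplecticSpreads

variable {K : Type u} [Field K] {V : Type v} [AddCommGroup V] [Module K V]

/-- `W` is totally isotropic for the bilinear form `B`. -/
def IsTotallyIsotropic (B : LinearMap.BilinForm K V) (W : Submodule K V) : Prop :=
  ∀ x ∈ W, ∀ y ∈ W, B x y = 0

/-- A symplectic partial spread of a space `V` of dimension `2n` with form `B`: a set of totally
isotropic `n`-dimensional subspaces, any two of which have only `0` in common. -/
structure IsSymplecticPartialSpread (B : LinearMap.BilinForm K V)
    (S : Set (Submodule K V)) : Prop where
  two_mul_finrank : ∀ W ∈ S, 2 * Module.finrank K W = Module.finrank K V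
  isotropic : ∀ W ∈ S, IsTotallyIsotropic B W
  inf_eq_bot : ∀ W ∈ S, ∀ W' ∈ S, W ≠ W' → W ⊓ W' = ⊥

/-- A maximal symplectic partial spread: maximal with respect to inclusion among the symplectic
partial spreads. -/
def IsMaximalSymplecticPartialSpread (B : LinearMap.BilinForm K V)
    (S : Set (Submodule K V)) : Prop :=
  Maximal (IsSymplecticPartialSpread B) S

/-- A symplectic spread: a symplectic partial spread whose members cover `V`. -/
structure IsSymplecticSpread (B : LinearMap.BilinForm K V)
    (S : Set (Submodule K V)) : Prop extends IsSymplecticPartialSpread B S where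
  cover : ∀ v : V, ∃ W ∈ S, v ∈ W

/-- A set of `K`-subspaces is a desarguesian spread if, for some structure on `V` of a
two-dimensional vector space over an extension field `F` of `K` (compatible with the given
`K`-structure), it is the set of all one-dimensional `F`-subspaces.
(Since `F` embeds in `V`, asking for `F` in the universe of `V` is no restriction.) -/
def IsDesarguesianSpread (S : Set (Submodule K V)) : Prop :=
  ∃ (F : Type v) (_ : Field F) (_ : Algebra K F) (_ : Module F V) (_ : IsScalarTower K F V),
    Module.finrank F V = 2 ∧
    S = {W | ∃ L : Submodule F V, Module.finrank F L = 1 ∧ W = L.restrictScalars K}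

/-- The members of `S` that meet `U` nontrivially. -/
def membersMeeting (S : Set (Submodule K V)) (U : Submodule K V) : Set (Submodule K V) :=
  {Y ∈ S | Y ⊓ U ≠ ⊥}

/-- The set obtained from `S` by replacing the members that meet `U` nontrivially with `U`. -/
def replaceBy (S : Set (Submodule K V)) (U : Submodule K V) : Set (Submodule K V) :=
  (S \ membersMeeting S U) ∪ {U}

end SymplecticSpreads

/-! Regard `V` as `F × F` with `F` cubic over `K`. The spread consists of the lines of slope in `F ∪
{∞}`, the slope of `(x, y)` being `x / y`. When `X` is the line of slope `∞` and `U` contains `(0,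
1)`, the condition `dim (U ∩ X) = 2` gives `U = A × K` with `A` a plane of `F`. The lines meeting
`U` have slope `∞` or slope in `A`, so there are `q ^ 2 + 1` of them, and the new set has `(q ^ 3 +
1) - (q ^ 2 + 1) + 1` members.

Maximality holds because any three-dimensional `W`, isotropic or not, that is disjoint from the
remaining lines has all its finite slopes in `A`, and then meets `A × K`
(`exists_mem_prod_of_forall_div_mem`). A `W` avoiding `A × K` would yield two planes of `F`, one
containing the inverses of all nonzero elements of the other. That is impossible, since `1/a`,
`1/b`, `1/(a+b)` are independent whenever `a`, `b` are: a relation would be a quadratic equation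
over `K` for `a/b`, an element of degree 3.

For existence, `V` is isometric to `F × F` with the trace of the determinant as form, and the
determinant vanishes on every `F`-line. -/

open Module

/-! ### Planes in a cubic extension -/

section CubicExtension

variable {K : Type*} [Field K] {F : Type*} [Field F] [Algebra K F]

/-- Elements of a cubic extension outside the base field satisfy no quadratic equation. -/
theorem coeff_eq_zero_of_quadratic_of_finrank_eq_three (h3 : finrank K F = 3) {t : F}
    (ht : t ∉ Set.range (algebraMap K F)) {a b c : K}
    (h : algebraMap K F a * t ^ 2 + algebraMap K F b * t + algebraMap K F c = 0) :
    a = 0 ∧ b = 0 ∧ c = 0 := by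
  have : FiniteDimensional K F := .of_finrank_pos (by omega)
  have hint : IsIntegral K t := .of_finite K t
  have hdeg : (minpoly K t).natDegree = 3 := by
    have hd := minpoly.degree_dvd (IsIntegral.of_finite K t)
    rw [h3] at hd
    rcases (Nat.dvd_prime Nat.prime_three).1 hd with h1 | h1
    · exact absurd ((minpoly.natDegree_eq_one_iff).1 h1) ht
    · exact h1
  open Polynomial in
  have hp : (C a * X ^ 2 + C b * X + C c : K[X]) = 0 := by
    by_contra hne
    have h1 := Polynomial.natDegree_le_natDegree (minpoly.degree_le_of_ne_zero K t hne (by simpa using h))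
    have h2 := Polynomial.natDegree_quadratic_le (a := a) (b := b) (c := c)
    omega
  refine ⟨?_, ?_, ?_⟩
  · simpa [Polynomial.coeff_X, Polynomial.coeff_C] using congrArg (Polynomial.coeff · 2) hp
  · simpa [Polynomial.coeff_X, Polynomial.coeff_C] using congrArg (Polynomial.coeff · 1) hp
  · simpa [Polynomial.coeff_X, Polynomial.coeff_C] using congrArg (Polynomial.coeff · 0) hp

/-- The inverses of the nonzero elements of a plane of a cubic extension do not lie in a plane. -/
theorem not_forall_inv_mem_of_finrank_eq_two (h3 : finrank K F = 3) {R A : Submodule K F}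
    (hR : finrank K R = 2) (hA : finrank K A = 2) : ¬ ∀ y ∈ R, y ≠ 0 → y⁻¹ ∈ A := by
  intro hinv
  have : FiniteDimensional K F := .of_finrank_pos (by omega)
  let v := Module.finBasisOfFinrankEq K R hR
  have hv : LinearIndependent K (fun i => (v i : F)) :=
    v.linearIndependent.map' R.subtype (Submodule.ker_subtype R)
  obtain ⟨a, ha, b, hb, hab⟩ : ∃ a ∈ R, ∃ b ∈ R, LinearIndependent K ![a, b] := by
    refine ⟨v 0, (v 0).2, v 1, (v 1).2, ?_⟩
    convert hv using 1
    ext i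
    fin_cases i <;> rfl
  have ha0 : a ≠ 0 := hab.ne_zero 0
  have hb0 : b ≠ 0 := hab.ne_zero 1
  rw [LinearIndependent.pair_iff] at hab
  have hs0 : a + b ≠ 0 := fun h => one_ne_zero (hab 1 1 (by simpa using h)).1
  have ht : a / b ∉ Set.range (algebraMap K F) := by
    rintro ⟨c, hc⟩
    rw [eq_div_iff hb0] at hc
    exact one_ne_zero (neg_eq_zero.1 (hab (-1) c (by rw [Algebra.smul_def c, hc]; simp)).1)
  have hli : LinearIndependent K ![(⟨a⁻¹, hinv a ha ha0⟩ : A), ⟨b⁻¹, hinv b hb hb0⟩,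
      ⟨(a + b)⁻¹, hinv _ (R.add_mem ha hb) hs0⟩] := by
    rw [Fintype.linearIndependent_iff]
    intro g hg
    have hg' := congrArg (Subtype.val) hg
    simp only [Fin.sum_univ_three, Algebra.smul_def, Matrix.cons_val_zero, Matrix.cons_val_one,
      Matrix.cons_val, Submodule.coe_add, Submodule.coe_smul, Submodule.coe_zero] at hg'
    -- Multiplying `g₀/a + g₁/b + g₂/(a+b) = 0` by `ab(a+b)/b²` gives this quadratic in `t = a/b`.
    obtain ⟨h1, h2, h0⟩ := coeff_eq_zero_of_quadratic_of_finrank_eq_three h3 ht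
      (a := g 1) (b := g 0 + g 1 + g 2) (c := g 0) (by
        rw [map_add, map_add]
        field_simp at hg' ⊢
        linear_combination hg')
    have h2' : g 2 = 0 := by simpa [h1, h0] using h2
    intro i
    fin_cases i <;> assumption
  have := hli.fintype_card_le_finrank
  simp [hA] at this

/-- Let `A` be a plane of a cubic extension. A three-dimensional space of pairs all of whose slopes
lie in `A` contains a nonzero element of `A × K`. -/
theorem exists_mem_prod_of_forall_div_mem (h3 : finrank K F = 3) {A : Submodule K F}
    (hA : finrank K A = 2) {W : Submodule K (F × F)} (hW : finrank K W = 3)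
    (hdiv : ∀ x y, (x, y) ∈ W → y ≠ 0 → x / y ∈ A) :
    ∃ w ∈ W, w ≠ 0 ∧ w ∈ A.prod (Submodule.span K {(1 : F)}) := by
  have : FiniteDimensional K F := .of_finrank_pos (by omega)
  let R := W.map (LinearMap.snd K F F)
  let N := W.comap (LinearMap.inl K F F)
  -- Rank-nullity for the second coordinate on `W`; the kernel is a copy of `N`.
  have hRN : finrank K R + finrank K N = 3 := by
    let f := (LinearMap.snd K F F).domRestrict W
    have hf := f.finrank_range_add_finrank_ker
    have h1 : LinearMap.range f = R := LinearMap.range_domRestrict _ _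
    have h2 : (LinearMap.ker f).map W.subtype = N.map (LinearMap.inl K F F) := by
      ext ⟨x, y⟩
      simp [f, N]
      grind
    have h3 := Submodule.finrank_map_subtype_eq W (LinearMap.ker f)
    have h4 : finrank K (N.map (LinearMap.inl K F F)) = finrank K N :=
      (Submodule.equivMapOfInjective _ LinearMap.inl_injective N).finrank_eq.symm
    rw [h2, h4] at h3
    rw [h1, ← h3, hW] at hf
    exact hf
  by_cases hone : (1 : F) ∈ R
  · obtain ⟨⟨x, y⟩, hxy, rfl : y = 1⟩ := hone
    refine ⟨(x, 1), hxy, by simp, ?_, Submodule.mem_span_singleton_self 1⟩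
    simpa using hdiv x 1 hxy one_ne_zero
  have hR3 : finrank K R < 3 := by
    rw [← h3]
    exact Submodule.finrank_lt (fun h => hone (h ▸ Submodule.mem_top))
  by_cases hN : 2 ≤ finrank K N
  -- Two subspaces of dimension at least 2 in the three-dimensional `F` meet.
  · have hne : A ⊓ N ≠ ⊥ := by
      intro hbot
      have h1 := Submodule.finrank_sup_add_finrank_inf_eq A N
      have h2 := Submodule.finrank_le (A ⊔ N)
      rw [hbot, finrank_bot] at h1
      omega
    obtain ⟨x, hx, hx0⟩ := Submodule.exists_mem_ne_zero_of_ne_bot hne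
    exact ⟨(x, 0), hx.2, by simpa using hx0, hx.1, Submodule.zero_mem _⟩
  have hNbot : N ≠ ⊥ := by
    intro h
    rw [h, finrank_bot] at hRN
    omega
  -- Here `dim N = 1` and `dim R = 2`. Adding `(z, 0)` to a vector `(x, y)` of `W` shows `z / y ∈
  -- A`, so `z⁻¹ A` contains the inverses of the nonzero elements of `R`.
  obtain ⟨z, hz, hz0⟩ := Submodule.exists_mem_ne_zero_of_ne_bot hNbot
  let m := LinearEquiv.smulOfNeZero F F z⁻¹ (inv_ne_zero hz0) |>.restrictScalars K
  refine absurd ?_ (not_forall_inv_mem_of_finrank_eq_two h3 (R := R)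
    (A := A.map (m : F →ₗ[K] F)) (by omega) (by rw [LinearEquiv.finrank_map_eq, hA]))
  rintro _ ⟨⟨x, y⟩, hxy, rfl⟩ (hy : y ≠ 0)
  refine ⟨z * y⁻¹, ?_, ?_⟩
  · have h1 := hdiv _ _ hxy hy
    have h2 := hdiv (x + z) y (by simpa using W.add_mem hxy hz) hy
    have h3 := A.sub_mem h2 h1
    rwa [← sub_div, add_sub_cancel_left, div_eq_mul_inv] at h3
  · change z⁻¹ * (z * y⁻¹) = y⁻¹
    field_simp

end CubicExtension

/-! ### Lines of the `F`-plane and the subspaces `A × K` -/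

section Lines

variable {K : Type u} [Field K] {F : Type w} [Field F] [Algebra K F]
  {V : Type v} [AddCommGroup V] [Module K V] [Module F V] [IsScalarTower K F V]

variable (K F V) in
/-- The one-dimensional `F`-subspaces of `V`, as `K`-subspaces. -/
def extensionLines : Set (Submodule K V) :=
  {W | ∃ L : Submodule F V, finrank F L = 1 ∧ W = L.restrictScalars K}

variable (K) in
/-- The lines of a plane with coordinates `Φ`: the line `y = 0` and the lines `x = a y`. -/
def lineOfSlope (Φ : (F × F) ≃ₗ[F] V) : Option F → Submodule K V
  | none => (Submodule.span F {Φ (1, 0)}).restrictScalars K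
  | some a => (Submodule.span F {Φ (a, 1)}).restrictScalars K

variable (Φ : (F × F) ≃ₗ[F] V)

theorem mem_lineOfSlope_none {x y : F} : Φ (x, y) ∈ lineOfSlope K Φ none ↔ y = 0 := by
  simp only [lineOfSlope, Submodule.restrictScalars_mem, Submodule.mem_span_singleton, ← map_smul,
    Φ.injective.eq_iff]
  simp [eq_comm]

theorem mem_lineOfSlope_some {a x y : F} :
    Φ (x, y) ∈ lineOfSlope K Φ (some a) ↔ x = y * a := by
  simp only [lineOfSlope, Submodule.restrictScalars_mem, Submodule.mem_span_singleton, ← map_smul,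
    Φ.injective.eq_iff]
  simp [eq_comm]

theorem lineOfSlope_injective : Function.Injective (lineOfSlope K Φ) := by
  rintro (_ | a) (_ | b) h
  · rfl
  · have := (mem_lineOfSlope_none (K := K) Φ (x := 1) (y := 0)).2 rfl
    rw [h, mem_lineOfSlope_some] at this
    simp at this
  · have := (mem_lineOfSlope_none (K := K) Φ (x := 1) (y := 0)).2 rfl
    rw [← h, mem_lineOfSlope_some] at this
    simp at this
  · have := (mem_lineOfSlope_some (K := K) Φ (a := a) (x := a) (y := 1)).2 (by simp)
    rw [h, mem_lineOfSlope_some] at this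
    simpa using this

theorem exists_eq_map (v : V) : ∃ x y, v = Φ (x, y) :=
  ⟨(Φ.symm v).1, (Φ.symm v).2, by simp⟩

theorem eq_of_mem_lineOfSlope {s t : Option F} {v : V} (hv : v ≠ 0)
    (hs : v ∈ lineOfSlope K Φ s) (ht : v ∈ lineOfSlope K Φ t) : s = t := by
  obtain ⟨x, y, rfl⟩ := exists_eq_map Φ v
  have hxy : x = 0 → y ≠ 0 := by
    rintro rfl rfl
    exact hv (by rw [← Prod.zero_eq_mk, map_zero])
  rcases s with _ | a <;> rcases t with _ | b <;>
    simp only [mem_lineOfSlope_none, mem_lineOfSlope_some] at hs ht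
  · rfl
  · subst hs
    exact absurd rfl (hxy (by simpa using ht))
  · subst ht
    exact absurd rfl (hxy (by simpa using hs))
  · have hy : y ≠ 0 := by
      rintro rfl
      exact hxy (by simpa using hs) rfl
    rw [mul_left_cancel₀ hy (hs.symm.trans ht)]

theorem exists_mem_lineOfSlope (v : V) : ∃ s, v ∈ lineOfSlope K Φ s := by
  obtain ⟨x, y, rfl⟩ := exists_eq_map Φ v
  by_cases hy : y = 0
  · exact ⟨none, (mem_lineOfSlope_none Φ).2 hy⟩
  · exact ⟨some (x / y), (mem_lineOfSlope_some Φ).2 (by field_simp)⟩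

theorem lineOfSlope_mem_extensionLines (s : Option F) :
    lineOfSlope K Φ s ∈ extensionLines K F V := by
  rcases s with _ | a <;> exact ⟨_, finrank_span_singleton (by simp), rfl⟩

theorem eq_span_singleton_of_finrank_eq_one {L : Submodule F V} (hL : finrank F L = 1) {v : V}
    (hv : v ∈ L) (hv0 : v ≠ 0) : L = Submodule.span F {v} := by
  have : FiniteDimensional F L := .of_finrank_pos (hL ▸ one_pos)
  refine (Submodule.eq_of_le_of_finrank_eq ?_ ?_).symm
  · rwa [Submodule.span_singleton_le_iff_mem]
  · rw [hL, finrank_span_singleton hv0]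

theorem range_lineOfSlope : Set.range (lineOfSlope K Φ) = extensionLines K F V := by
  ext W
  constructor
  · rintro ⟨s, rfl⟩
    exact lineOfSlope_mem_extensionLines Φ s
  · rintro ⟨L, hL, rfl⟩
    obtain ⟨v, hv, hv0⟩ := Submodule.exists_mem_ne_zero_of_ne_bot
      (p := L) (by rintro rfl; simp at hL)
    obtain ⟨s, hs⟩ := exists_mem_lineOfSlope (K := K) Φ v
    obtain ⟨L', hL', h⟩ := lineOfSlope_mem_extensionLines (K := K) Φ s
    rw [h] at hs
    refine ⟨s, ?_⟩
    rw [h, eq_span_singleton_of_finrank_eq_one hL hv hv0,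
      eq_span_singleton_of_finrank_eq_one hL' hs hv0]

/-- Coordinates on a plane for which a given line is `y = 0` and a given vector outside it is
`(0, 1)`. -/
theorem exists_coordinates (hV : finrank F V = 2) {X : Submodule K V}
    (hX : X ∈ extensionLines K F V) {u : V} (hu : u ∉ X) :
    ∃ Φ : (F × F) ≃ₗ[F] V, Φ (0, 1) = u ∧ X = lineOfSlope K Φ none := by
  obtain ⟨L, hL, rfl⟩ := hX
  have : FiniteDimensional F V := .of_finrank_pos (by omega)
  obtain ⟨e, he, he0⟩ := Submodule.exists_mem_ne_zero_of_ne_bot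
    (p := L) (by rintro rfl; simp at hL)
  have hLe := eq_span_singleton_of_finrank_eq_one hL he he0
  let f : (F × F) →ₗ[F] V :=
    (LinearMap.toSpanSingleton F V e).coprod (LinearMap.toSpanSingleton F V u)
  have hinj : Function.Injective f := by
    rw [injective_iff_map_eq_zero]
    rintro ⟨x, y⟩ (h : x • e + y • u = 0)
    have hy : y = 0 := by
      by_contra hy
      refine hu ((L.smul_mem_iff hy).1 ?_)
      rw [eq_neg_of_add_eq_zero_right h]
      exact L.neg_mem (L.smul_mem x he)
    have hx : x = 0 := by
      subst hy
      simpa [he0] using h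
    rw [hx, hy, Prod.zero_eq_mk]
  refine ⟨LinearEquiv.ofBijective f ⟨hinj, ?_⟩, ?_, ?_⟩
  · exact (LinearMap.injective_iff_surjective_of_finrank_eq_finrank
      (by rw [finrank_prod, hV, finrank_self])).1 hinj
  · change f (0, 1) = u
    simp [f]
  · change _ = (Submodule.span F {f (1, 0)}).restrictScalars K
    simp [f, hLe]

variable (K) in
/-- The `K`-subspace `A × K` in the coordinates `Φ`. -/
def subspaceOfSlopes (A : Submodule K F) : Submodule K V :=
  (A.prod (Submodule.span K {(1 : F)})).map (Φ.restrictScalars K : (F × F) →ₗ[K] V)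

theorem mem_subspaceOfSlopes {A : Submodule K F} {x y : F} :
    Φ (x, y) ∈ subspaceOfSlopes K Φ A ↔ x ∈ A ∧ ∃ k : K, algebraMap K F k = y := by
  simp [subspaceOfSlopes, Submodule.mem_span_singleton, Algebra.algebraMap_eq_smul_one,
    Submodule.mem_map]

theorem finrank_subspaceOfSlopes [FiniteDimensional K F] (A : Submodule K F) :
    finrank K (subspaceOfSlopes K Φ A) = finrank K A + 1 := by
  let j : (A × K) →ₗ[K] V := (Φ.restrictScalars K : (F × F) →ₗ[K] V) ∘ₗ
    A.subtype.prodMap (Algebra.linearMap K F)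
  have hj : Function.Injective j :=
    Φ.injective.comp (Function.Injective.prodMap A.subtype_injective (algebraMap K F).injective)
  have hr : LinearMap.range j = subspaceOfSlopes K Φ A := by
    ext v
    obtain ⟨x, y, rfl⟩ := exists_eq_map Φ v
    simp [mem_subspaceOfSlopes, j]
  rw [← hr, LinearMap.finrank_range_of_inj hj, finrank_prod, finrank_self]

theorem finrank_subspaceOfSlopes_inf_lineOfSlope (A : Submodule K F) :
    finrank K (subspaceOfSlopes K Φ A ⊓ lineOfSlope K Φ none : Submodule K V) = finrank K A := by
  let j : F →ₗ[K] V := (Φ.restrictScalars K : (F × F) →ₗ[K] V) ∘ₗ LinearMap.inl K F F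
  have hj : Function.Injective j := Φ.injective.comp LinearMap.inl_injective
  have hr : A.map j = subspaceOfSlopes K Φ A ⊓ lineOfSlope K Φ none := by
    ext v
    obtain ⟨x, y, rfl⟩ := exists_eq_map Φ v
    simp [mem_subspaceOfSlopes, mem_lineOfSlope_none, j]
    grind [map_zero (algebraMap K F)]
  rw [← hr, (Submodule.equivMapOfInjective j hj A).finrank_eq]

/-- Any vector of `U` outside `X` can serve as `(0, 1)`. With `A` read off from `U ∩ X`, the space
`A × K` lies in `U`, and the dimensions agree. -/
theorem exists_eq_subspaceOfSlopes [FiniteDimensional K F] (hV : finrank F V = 2)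
    {X U : Submodule K V} (hX : X ∈ extensionLines K F V) (hU : finrank K U = 3)
    (hUX : finrank K (U ⊓ X : Submodule K V) = 2) :
    ∃ (Φ : (F × F) ≃ₗ[F] V) (A : Submodule K F), finrank K A = 2 ∧
      X = lineOfSlope K Φ none ∧ U = subspaceOfSlopes K Φ A := by
  have : FiniteDimensional F V := .of_finrank_pos (by omega)
  have : FiniteDimensional K V := .trans K F V
  obtain ⟨u, huU, huX⟩ : ∃ u ∈ U, u ∉ X := by
    by_contra! h
    rw [inf_eq_left.2 h] at hUX
    omega
  obtain ⟨Φ, rfl, rfl⟩ := exists_coordinates hV hX huX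
  let j : F →ₗ[K] V := (Φ.restrictScalars K : (F × F) →ₗ[K] V) ∘ₗ LinearMap.inl K F F
  have hj : Function.Injective j := Φ.injective.comp LinearMap.inl_injective
  have hjx : ∀ x, j x = Φ (x, 0) := fun _ => rfl
  have hmap : (U.comap j).map j = U ⊓ lineOfSlope K Φ none := by
    ext v
    obtain ⟨x, y, rfl⟩ := exists_eq_map Φ v
    simp only [Submodule.mem_map, Submodule.mem_comap, Submodule.mem_inf, hjx,
      Φ.injective.eq_iff, mem_lineOfSlope_none, Prod.mk.injEq]
    grind
  have hA : finrank K (U.comap j) = 2 := by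
    rw [(Submodule.equivMapOfInjective j hj _).finrank_eq, hmap, hUX]
  refine ⟨Φ, U.comap j, hA, rfl, (Submodule.eq_of_le_of_finrank_eq ?_ ?_).symm⟩
  · intro v hv
    obtain ⟨x, y, rfl⟩ := exists_eq_map Φ v
    obtain ⟨hx, k, rfl⟩ := (mem_subspaceOfSlopes Φ).1 hv
    have : Φ (x, algebraMap K F k) = j x + k • Φ (0, 1) := by
      rw [← algebraMap_smul F k (Φ (0, 1)), ← map_smul, hjx, ← map_add]
      simp [Algebra.algebraMap_eq_smul_one]
    rw [this]
    exact U.add_mem hx (U.smul_mem k huU)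
  · rw [finrank_subspaceOfSlopes, hA, hU]

/-- A nonzero `(x, k)` with `x ∈ A`, `k ∈ K` has slope `∞` or `k⁻¹ x ∈ A`. Slope `∞` does occur
because `A ≠ 0`. -/
theorem lineOfSlope_inf_subspaceOfSlopes_ne_bot {A : Submodule K F} (hA : A ≠ ⊥) {s : Option F} :
    lineOfSlope K Φ s ⊓ subspaceOfSlopes K Φ A ≠ ⊥ ↔ s ∈ insert none (some '' (A : Set F)) := by
  rw [Submodule.ne_bot_iff]
  constructor
  · rintro ⟨v, ⟨hv, hv'⟩, hv0⟩
    obtain ⟨x, y, rfl⟩ := exists_eq_map Φ v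
    obtain ⟨hx, k, rfl⟩ := (mem_subspaceOfSlopes Φ).1 hv'
    by_cases hk : k = 0
    · subst hk
      exact .inl (eq_of_mem_lineOfSlope Φ hv0 hv ((mem_lineOfSlope_none Φ).2 (map_zero _)))
    · refine .inr ⟨k⁻¹ • x, A.smul_mem _ hx, eq_of_mem_lineOfSlope Φ hv0
        ((mem_lineOfSlope_some Φ).2 ?_) hv⟩
      rw [← Algebra.smul_def, smul_inv_smul₀ hk]
  · rintro (rfl | ⟨a, ha, rfl⟩)
    · obtain ⟨a, ha, ha0⟩ := Submodule.exists_mem_ne_zero_of_ne_bot hA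
      exact ⟨Φ (a, 0), ⟨(mem_lineOfSlope_none Φ).2 rfl,
        (mem_subspaceOfSlopes Φ).2 ⟨ha, 0, map_zero _⟩⟩, by simpa using ha0⟩
    · exact ⟨Φ (a, 1), ⟨(mem_lineOfSlope_some Φ).2 (by simp),
        (mem_subspaceOfSlopes Φ).2 ⟨ha, 1, map_one _⟩⟩, by simp⟩

theorem membersMeeting_extensionLines {A : Submodule K F} (hA : A ≠ ⊥) :
    membersMeeting (extensionLines K F V) (subspaceOfSlopes K Φ A) =
      lineOfSlope K Φ '' insert none (some '' (A : Set F)) := by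
  ext W
  rw [membersMeeting, ← range_lineOfSlope Φ]
  constructor
  · rintro ⟨⟨s, rfl⟩, hs⟩
    exact ⟨s, (lineOfSlope_inf_subspaceOfSlopes_ne_bot Φ hA).1 hs, rfl⟩
  · rintro ⟨s, hs, rfl⟩
    exact ⟨⟨s, rfl⟩, (lineOfSlope_inf_subspaceOfSlopes_ne_bot Φ hA).2 hs⟩

theorem ncard_extensionLines [Finite F] (hV : finrank F V = 2) :
    (extensionLines K F V).ncard = Nat.card F + 1 := by
  have : FiniteDimensional F V := .of_finrank_pos (by omega)
  let Φ : (F × F) ≃ₗ[F] V := .ofFinrankEq _ _ (by rw [finrank_prod, hV, finrank_self])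
  rw [← range_lineOfSlope Φ, ← Set.image_univ,
    Set.ncard_image_of_injective _ (lineOfSlope_injective Φ), Set.ncard_univ, Finite.card_option]

theorem ncard_membersMeeting_extensionLines [Finite F] {A : Submodule K F} (hA : A ≠ ⊥) :
    (membersMeeting (extensionLines K F V) (subspaceOfSlopes K Φ A)).ncard = Nat.card A + 1 := by
  rw [membersMeeting_extensionLines Φ hA,
    Set.ncard_image_of_injective _ (lineOfSlope_injective Φ), Set.ncard_insert_of_notMem (by simp),
    Set.ncard_image_of_injective _ (Option.some_injective F), ← Nat.card_coe_set_eq]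
  rfl

/-- A three-dimensional `K`-subspace with only zero in common with the lines that miss `A × K`
meets `A × K`. -/
theorem inf_subspaceOfSlopes_ne_bot (h3 : finrank K F = 3) {A : Submodule K F}
    (hA : finrank K A = 2) {W : Submodule K V} (hW : finrank K W = 3)
    (hdisj : ∀ Y ∈ extensionLines K F V \
      membersMeeting (extensionLines K F V) (subspaceOfSlopes K Φ A), W ⊓ Y = ⊥) :
    W ⊓ subspaceOfSlopes K Φ A ≠ ⊥ := by
  have hA0 : A ≠ ⊥ := by
    rintro rfl
    simp at hA
  let Ψ : (F × F) ≃ₗ[K] V := Φ.restrictScalars K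
  obtain ⟨w, hw, hw0, hwA⟩ := exists_mem_prod_of_forall_div_mem h3 hA
    (W := W.map (Ψ.symm : V →ₗ[K] F × F)) (by rw [LinearEquiv.finrank_map_eq, hW]) (by
      rintro x y ⟨v, hv, hxy⟩ hy
      have hv' : v = Φ (x, y) := (LinearEquiv.symm_apply_eq Ψ).1 hxy
      subst hv'
      -- If `x / y ∉ A`, the line of that slope misses `A × K`, yet shares `(x, y)` with `W`.
      by_contra hx
      have hmem : Φ (x, y) ∈ lineOfSlope K Φ (some (x / y)) :=
        (mem_lineOfSlope_some Φ).2 (by field_simp)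
      have := hdisj (lineOfSlope K Φ (some (x / y))) ⟨range_lineOfSlope (K := K) Φ ▸ ⟨_, rfl⟩, by
        rintro ⟨-, h⟩
        rw [lineOfSlope_inf_subspaceOfSlopes_ne_bot Φ hA0] at h
        simp [hx] at h⟩
      have h0 : Φ (x, y) ∈ (⊥ : Submodule K V) := this ▸ ⟨hv, hmem⟩
      simp [hy] at h0)
  obtain ⟨v, hv, rfl⟩ := hw
  refine (Submodule.ne_bot_iff _).2 ⟨v, ⟨hv, ?_⟩, ?_⟩
  · exact ⟨_, hwA, Ψ.apply_symm_apply v⟩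
  · rintro rfl
    exact hw0 (map_zero _)

end Lines

/-! ### Symplectic bases and the trace form -/

section Existence

/-- A nondegenerate alternating form on a space of dimension `2n` has a symplectic basis. -/
theorem LinearMap.BilinForm.IsAlt.exists_symplectic_family {K : Type u} [Field K] (n : ℕ) :
    ∀ {V : Type v} [AddCommGroup V] [Module K V] [FiniteDimensional K V],
      finrank K V = 2 * n → ∀ B : LinearMap.BilinForm K V, B.IsAlt → B.Nondegenerate →
      ∃ e f : Fin n → V, (∀ i j, B (e i) (e j) = 0) ∧ (∀ i j, B (f i) (f j) = 0) ∧
        ∀ i j, B (e i) (f j) = if i = j then 1 else 0 := by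
  induction n with
  | zero => exact fun _ _ _ _ => ⟨0, 0, fun i => i.elim0, fun i => i.elim0, fun i => i.elim0⟩
  | succ n ih =>
    intro V _ _ _ hV B hAlt hB
    have : Nontrivial V := Module.nontrivial_of_finrank_pos (R := K) (by omega)
    obtain ⟨x, hx⟩ := exists_ne (0 : V)
    obtain ⟨y, hxy⟩ : ∃ y, B x y = 1 := by
      have hx' : ∃ y, B x y ≠ 0 := by
        by_contra! h
        exact hx (hB.1 x h)
      obtain ⟨y, hy⟩ := hx'
      exact ⟨(B x y)⁻¹ • y, by simp [hy]⟩
    have hyx : B y x = -1 := by rw [← hAlt.neg_eq, hxy]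
    -- Split off the hyperbolic plane `P` and apply induction to its orthogonal complement.
    let P := Submodule.span K {x, y}
    have hdisj : Disjoint P (B.orthogonal P) := by
      rw [Submodule.disjoint_def]
      intro v hv hv'
      obtain ⟨a, b, rfl⟩ := Submodule.mem_span_pair.1 hv
      have h1 := hv' x (Submodule.subset_span (by simp))
      have h2 := hv' y (Submodule.subset_span (by simp))
      simp only [map_add, map_smul, hxy, hyx, hAlt.self_eq_zero,
        smul_eq_mul] at h1 h2
      have hb : b = 0 := by simpa using h1
      have ha : a = 0 := by simpa using h2
      simp [ha, hb]
    have hcompl : IsCompl P (B.orthogonal P) :=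
      (LinearMap.BilinForm.isCompl_orthogonal_iff_disjoint hAlt.isRefl).2 hdisj
    have hP : finrank K P = 2 := by
      have hli : LinearIndependent K ![x, y] := by
        rw [LinearIndependent.pair_iff]
        intro s t h
        have h1 := congrArg (B x) h
        have h2 := congrArg (B y) h
        simp only [map_add, map_smul, hxy, hyx, hAlt.self_eq_zero, smul_eq_mul, map_zero] at h1 h2
        exact ⟨by simpa using h2, by simpa using h1⟩
      have := finrank_span_eq_card hli
      rwa [Matrix.range_cons_cons_empty, Fintype.card_fin] at this
    have hfr : finrank K (B.orthogonal P) = 2 * n := by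
      have := Submodule.finrank_add_eq_of_isCompl hcompl
      omega
    have hnd : (B.restrict (B.orthogonal P)).Nondegenerate := by
      rw [LinearMap.BilinForm.restrict_nondegenerate_iff_isCompl_orthogonal hAlt.isRefl,
        LinearMap.BilinForm.orthogonal_orthogonal hB hAlt.isRefl]
      exact hcompl.symm
    obtain ⟨e, f, he, hf, hef⟩ := ih hfr _ (fun v => hAlt v) hnd
    have hx0 : ∀ v : B.orthogonal P, B x v = 0 :=
      fun v => v.2 x (Submodule.subset_span (by simp))
    have hy0 : ∀ v : B.orthogonal P, B y v = 0 :=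
      fun v => v.2 y (Submodule.subset_span (by simp))
    have hx0' : ∀ v : B.orthogonal P, B v x = 0 := fun v => hAlt.isRefl _ _ (hx0 v)
    have hy0' : ∀ v : B.orthogonal P, B v y = 0 := fun v => hAlt.isRefl _ _ (hy0 v)
    refine ⟨Fin.cons x (fun i => e i), Fin.cons y (fun i => f i), ?_, ?_, ?_⟩
    · intro i j
      refine Fin.cases ?_ (fun i => ?_) i <;> refine Fin.cases ?_ (fun j => ?_) j
      · simp [hAlt.self_eq_zero]
      · simp [hx0]
      · simp [hx0']
      · simpa using he i j
    · intro i j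
      refine Fin.cases ?_ (fun i => ?_) i <;> refine Fin.cases ?_ (fun j => ?_) j
      · simp [hAlt.self_eq_zero]
      · simp [hy0]
      · simp [hy0']
      · simpa using hf i j
    · intro i j
      refine Fin.cases ?_ (fun i => ?_) i <;> refine Fin.cases ?_ (fun j => ?_) j
      · simp [hxy]
      · simp [hx0, (Fin.succ_ne_zero j).symm]
      · simp [hy0']
      · simpa using hef i j

/-- A symplectic space over `K` of dimension `2 [F : K]` is isometric to `F × F` with the form
`Tr (x y' - y x')`. -/
theorem exists_linearEquiv_trace_form {K : Type u} [Field K] {F : Type*} [Field F] [Algebra K F]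
    [FiniteDimensional K F] [Algebra.IsSeparable K F]
    {V : Type v} [AddCommGroup V] [Module K V] (hV : finrank K V = 2 * finrank K F)
    (B : LinearMap.BilinForm K V) (hAlt : B.IsAlt) (hB : B.Nondegenerate) :
    ∃ Φ : (F × F) ≃ₗ[K] V, ∀ z w : F × F,
      B (Φ z) (Φ w) = Algebra.trace K F (z.1 * w.2 - z.2 * w.1) := by
  have hpos : 0 < finrank K F := finrank_pos
  have : FiniteDimensional K V := .of_finrank_pos (by omega)
  obtain ⟨e, f, he, hf, hef⟩ := hAlt.exists_symplectic_family (finrank K F) hV B hB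
  let b := finBasis K F
  have hT : (Algebra.traceForm K F).Nondegenerate := traceForm_nondegenerate K F
  -- Sending a basis to `e` and its trace-dual basis to `f` turns the pairing of `e` with `f` into
  -- the trace form.
  let b' := (Algebra.traceForm K F).dualBasis hT b
  let Φ : (F × F) →ₗ[K] V := (b.constr K e).coprod (b'.constr K f)
  have hfe : ∀ i j, B (f i) (e j) = if i = j then -1 else 0 := by
    intro i j
    rw [← hAlt.neg_eq, hef]
    grind
  have htr : ∀ i j, Algebra.trace K F (b i * b' j) = if i = j then 1 else 0 :=
    (Algebra.traceForm K F).apply_dualBasis_right hT (Algebra.traceForm_isSymm K) b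
  have htr' : ∀ i j, Algebra.trace K F (b' i * b j) = if i = j then 1 else 0 := by
    intro i j
    rw [mul_comm, htr]
    grind
  have h11 : ∀ x x', B (Φ (x, 0)) (Φ (x', 0)) = 0 := by
    intro x x'
    have : B.compl₁₂ (b.constr K e) (b.constr K e) = 0 :=
      b.ext fun i => b.ext fun j => by simp [he]
    simpa [Φ] using LinearMap.congr_fun₂ this x x'
  have h22 : ∀ y y', B (Φ (0, y)) (Φ (0, y')) = 0 := by
    intro x x'
    have : B.compl₁₂ (b'.constr K f) (b'.constr K f) = 0 :=
      b'.ext fun i => b'.ext fun j => by simp [hf]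
    simpa [Φ] using LinearMap.congr_fun₂ this x x'
  have h12 : ∀ x y, B (Φ (x, 0)) (Φ (0, y)) = Algebra.trace K F (x * y) := by
    intro x y
    have : B.compl₁₂ (b.constr K e) (b'.constr K f) = Algebra.traceForm K F :=
      b.ext fun i => b'.ext fun j => by simp [hef, htr]
    simpa [Φ] using LinearMap.congr_fun₂ this x y
  have hform : ∀ z w : F × F,
      B (Φ z) (Φ w) = Algebra.trace K F (z.1 * w.2 - z.2 * w.1) := by
    rintro ⟨x, y⟩ ⟨x', y'⟩
    have hz : ∀ x y, Φ (x, y) = Φ (x, 0) + Φ (0, y) := fun x y => by simp [← map_add]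
    rw [hz x, hz x']
    simp only [map_add, LinearMap.add_apply, h11, h22, h12]
    rw [← hAlt.neg_eq, h12, map_sub, mul_comm y]
    ring
  have hinj : Function.Injective Φ := by
    rw [injective_iff_map_eq_zero]
    rintro ⟨x, y⟩ h
    have hx : x = 0 := hT.1 x fun y' => by
      have := hform (x, y) (0, y')
      simpa [h] using this.symm
    have hy : y = 0 := hT.1 y fun x' => by
      have := hform (x, y) (x', 0)
      simpa [h] using this.symm
    simp [hx, hy]
  refine ⟨LinearEquiv.ofBijective Φ ⟨hinj, ?_⟩, hform⟩
  exact (LinearMap.injective_iff_surjective_of_finrank_eq_finrank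
    (by rw [finrank_prod, hV, two_mul])).1 hinj

end Existence

/-! ### Replacing the lines that meet `U` -/

section Replacement

variable {K : Type u} [Field K] {F : Type w} [Field F] [Algebra K F]
  {V : Type v} [AddCommGroup V] [Module K V] [Module F V] [IsScalarTower K F V]
  {B : LinearMap.BilinForm K V}

/-- If all `F`-lines are totally isotropic then scalars from `F` are self-adjoint. -/
theorem smul_left_eq_smul_right (hAlt : B.IsAlt)
    (hS : IsSymplecticSpread B (extensionLines K F V)) (c : F) (v w : V) :
    B (c • v) w = B v (c • w) := by
  have h : ∀ v : V, B v (c • v) = 0 := by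
    intro v
    by_cases hv : v = 0
    · simp [hv]
    have hmem : (Submodule.span F {v}).restrictScalars K ∈ extensionLines K F V :=
      ⟨_, finrank_span_singleton hv, rfl⟩
    exact hS.isotropic _ hmem _ (Submodule.mem_span_singleton_self v) _
      (Submodule.smul_mem _ c (Submodule.mem_span_singleton_self v))
  -- Polarization of `B v (c • v) = 0`.
  have h1 := h (v + w)
  simp only [smul_add, map_add, LinearMap.add_apply, h, zero_add, add_zero] at h1
  rw [← hAlt.neg_eq, eq_comm, ← add_eq_zero_iff_eq_neg, ← h1]
  exact add_comm _ _

/-- For `u` outside `X`, the functional `B · u` on `X` is nonzero, so its kernel is a plane; that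
plane together with `u` spans `U`. -/
theorem exists_isTotallyIsotropic_finrank_inf_eq_two (h3 : finrank K F = 3)
    (hV : finrank F V = 2) (hAlt : B.IsAlt) (hB : B.Nondegenerate)
    (hS : IsSymplecticSpread B (extensionLines K F V)) {X : Submodule K V}
    (hX : X ∈ extensionLines K F V) :
    ∃ U : Submodule K V, IsTotallyIsotropic B U ∧ finrank K U = 3 ∧
      finrank K (U ⊓ X : Submodule K V) = 2 := by
  have : FiniteDimensional K F := .of_finrank_pos (by omega)
  have hadj := smul_left_eq_smul_right hAlt hS
  obtain ⟨u, hu⟩ : ∃ u, u ∉ X := by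
    by_contra! h
    obtain ⟨L, hL, rfl⟩ := hX
    have hLtop : L = ⊤ := Submodule.eq_top_iff'.2 h
    rw [hLtop, finrank_top, hV] at hL
    omega
  obtain ⟨Φ, hΦ, rfl⟩ := exists_coordinates hV hX hu
  let g : F →ₗ[K] K := (B.flip u) ∘ₗ (Φ.restrictScalars K : (F × F) →ₗ[K] V) ∘ₗ
    LinearMap.inl K F F
  have hg : ∀ a, g a = B (Φ (a, 0)) (Φ (0, 1)) := fun a => by rw [hΦ]; rfl
  have hXiso : ∀ x x', B (Φ (x, 0)) (Φ (x', 0)) = 0 := fun x x' =>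
    hS.isotropic _ hX _ ((mem_lineOfSlope_none Φ).2 rfl) _ ((mem_lineOfSlope_none Φ).2 rfl)
  have hsplit : ∀ x y, Φ (x, y) = Φ (x, 0) + y • Φ (0, 1) := fun x y => by
    rw [← map_smul, ← map_add]
    simp
  -- By self-adjointness `B (1, 0) (x, y) = g y`, so `g = 0` would put `(1, 0)` in the radical.
  have hg0 : g ≠ 0 := by
    intro h0
    have : Φ (1, 0) = 0 := hB.1 _ fun v => by
      obtain ⟨x, y, rfl⟩ := exists_eq_map Φ v
      have h1 : B (Φ (y, 0)) (Φ (0, 1)) = 0 := by rw [← hg, h0, LinearMap.zero_apply]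
      rw [hsplit x, map_add, hXiso, ← hadj, ← map_smul, zero_add, ← h1]
      simp
    simp at this
  have hA : finrank K (LinearMap.ker g) = 2 := by
    have h1 := g.finrank_range_add_finrank_ker
    rw [LinearMap.range_eq_top.2 (LinearMap.surjective hg0), finrank_top, finrank_self, h3] at h1
    omega
  refine ⟨subspaceOfSlopes K Φ (LinearMap.ker g), ?_, by rw [finrank_subspaceOfSlopes, hA],
    by rw [finrank_subspaceOfSlopes_inf_lineOfSlope, hA]⟩
  intro v hv w hw
  obtain ⟨x, y, rfl⟩ := exists_eq_map Φ v
  obtain ⟨x', y', rfl⟩ := exists_eq_map Φ w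
  obtain ⟨hx, k, rfl⟩ := (mem_subspaceOfSlopes Φ).1 hv
  obtain ⟨hx', k', rfl⟩ := (mem_subspaceOfSlopes Φ).1 hw
  rw [LinearMap.mem_ker, hg] at hx hx'
  have hx'' := hAlt.isRefl _ _ hx'
  rw [hsplit, hsplit x', algebraMap_smul, algebraMap_smul]
  simp [hXiso, hx, hx'', hAlt.self_eq_zero]

theorem IsSymplecticPartialSpread.replaceBy {S : Set (Submodule K V)}
    (hS : IsSymplecticPartialSpread B S) {U : Submodule K V} (hU : IsTotallyIsotropic B U)
    (hdim : 2 * finrank K U = finrank K V) : IsSymplecticPartialSpread B (replaceBy S U) := by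
  have hdisj : ∀ W ∈ S \ membersMeeting S U, W ⊓ U = ⊥ := by
    intro W hW
    by_contra h
    exact hW.2 ⟨hW.1, h⟩
  refine ⟨?_, ?_, ?_⟩
  · rintro W (hW | rfl)
    exacts [hS.two_mul_finrank W hW.1, hdim]
  · rintro W (hW | rfl)
    exacts [hS.isotropic W hW.1, hU]
  · rintro W (hW | rfl) W' (hW' | rfl) hne
    · exact hS.inf_eq_bot W hW.1 W' hW'.1 hne
    · exact hdisj W hW
    · rw [inf_comm]
      exact hdisj W' hW'
    · exact absurd rfl hne

theorem isMaximalSymplecticPartialSpread_replaceBy (h3 : finrank K F = 3)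
    (hV : finrank F V = 2) (hS : IsSymplecticSpread B (extensionLines K F V))
    (Φ : (F × F) ≃ₗ[F] V) {A : Submodule K F} (hA : finrank K A = 2)
    (hU : IsTotallyIsotropic B (subspaceOfSlopes K Φ A)) :
    IsMaximalSymplecticPartialSpread B
      (replaceBy (extensionLines K F V) (subspaceOfSlopes K Φ A)) := by
  have : FiniteDimensional K F := .of_finrank_pos (by omega)
  have h6 : finrank K V = 6 := by rw [← finrank_mul_finrank K F V, h3, hV]
  refine ⟨hS.replaceBy hU (by rw [finrank_subspaceOfSlopes, hA, h6]), fun T hT hle W hW => ?_⟩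
  by_contra hnot
  have hne : ∀ Y ∈ replaceBy (extensionLines K F V) (subspaceOfSlopes K Φ A), W ⊓ Y = ⊥ :=
    fun Y hY => hT.inf_eq_bot W hW Y (hle hY) (by rintro rfl; exact hnot hY)
  have hW3 : finrank K W = 3 := by
    have := hT.two_mul_finrank W hW
    omega
  exact inf_subspaceOfSlopes_ne_bot Φ h3 hA hW3 (fun Y hY => hne Y (.inl hY)) (hne _ (.inr rfl))

theorem ncard_replaceBy_extensionLines [Finite F] (hV : finrank F V = 2) (Φ : (F × F) ≃ₗ[F] V)
    {A : Submodule K F} (hA : A ≠ ⊥)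
    (hU : subspaceOfSlopes K Φ A ∉ extensionLines K F V) :
    (replaceBy (extensionLines K F V) (subspaceOfSlopes K Φ A)).ncard =
      Nat.card F - Nat.card A + 1 := by
  have : Finite V := .of_equiv _ Φ.toEquiv
  have : Finite (Submodule K V) := inferInstance
  rw [replaceBy, Set.union_singleton, Set.ncard_insert_of_notMem (fun h => hU h.1),
    Set.ncard_sdiff (fun W hW => hW.1), ncard_extensionLines hV,
    ncard_membersMeeting_extensionLines Φ hA]
  omega

/-- `A × K` contains `(a, 0)` with `a ≠ 0` and `(0, 1)`, which lie on different lines. -/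
theorem subspaceOfSlopes_notMem_extensionLines
    (Φ : (F × F) ≃ₗ[F] V) {A : Submodule K F} (hA : finrank K A = 2) :
    subspaceOfSlopes K Φ A ∉ extensionLines K F V := by
  have hA0 : A ≠ ⊥ := by
    rintro rfl
    simp at hA
  rw [← range_lineOfSlope Φ]
  rintro ⟨s, hs⟩
  obtain ⟨a, ha, ha0⟩ := Submodule.exists_mem_ne_zero_of_ne_bot hA0
  have h1 : Φ (a, 0) ∈ lineOfSlope K Φ s := by
    rw [hs, mem_subspaceOfSlopes]
    exact ⟨ha, 0, map_zero _⟩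
  have h2 : Φ (0, 1) ∈ lineOfSlope K Φ s := by
    rw [hs, mem_subspaceOfSlopes]
    exact ⟨A.zero_mem, 1, map_one _⟩
  obtain rfl : s = none :=
    eq_of_mem_lineOfSlope Φ (by simpa using ha0) h1 ((mem_lineOfSlope_none (K := K) Φ).2 rfl)
  simp [mem_lineOfSlope_none] at h2

end Replacement

/-! ### The desarguesian symplectic spread and the main theorem -/

/-- A six-dimensional symplectic space over a finite field has a desarguesian symplectic spread. -/
theorem exists_isDesarguesianSpread_isSymplecticSpread {K : Type u} [Field K] [Finite K]
    {V : Type v} [AddCommGroup V] [Module K V] (hV : finrank K V = 6)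
    (B : LinearMap.BilinForm K V) (hAlt : B.IsAlt) (hB : B.Nondegenerate) :
    ∃ S : Set (Submodule K V), IsDesarguesianSpread S ∧ IsSymplecticSpread B S := by
  obtain ⟨p, _⟩ := CharP.exists K
  have : Fact p.Prime := ⟨CharP.char_is_prime K p⟩
  -- The lift places `F` in the universe of `V`, as `IsDesarguesianSpread` demands.
  let F : Type v := ULift.{v} (FiniteField.Extension K p 3)
  have h3 : finrank K F = 3 := finrank_ulift.trans (FiniteField.finrank_extension K p 3)
  have : Finite F := inferInstanceAs (Finite (ULift _))
  have : FiniteDimensional K F := .of_finrank_pos (by omega)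
  obtain ⟨Φ, hΦ⟩ := exists_linearEquiv_trace_form (F := F) (by rw [hV, h3]) B hAlt hB
  -- The `F`-structure is transported from `F × F` along the isometry.
  let _ : SMul F V := ⟨fun c v => Φ (c • Φ.symm v)⟩
  have hsmul : ∀ (c : F) v, Φ.symm (c • v) = c • Φ.symm v := fun c v => Φ.symm_apply_apply _
  let _ : Module F V := Function.Injective.module F Φ.symm.toLinearMap.toAddMonoidHom
    Φ.symm.injective hsmul
  have : IsScalarTower K F V := ⟨fun k c v => Φ.symm.injective (by
    rw [hsmul, map_smul, hsmul, smul_assoc])⟩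
  let Ψ : (F × F) ≃ₗ[F] V := LinearEquiv.symm
    { Φ.symm with map_smul' := hsmul }
  have hΨ : ∀ z w, B (Ψ z) (Ψ w) = Algebra.trace K F (z.1 * w.2 - z.2 * w.1) := hΦ
  have hV2 : finrank F V = 2 := by rw [← Ψ.finrank_eq, finrank_prod, finrank_self]
  refine ⟨extensionLines K F V, ⟨F, _, _, _, _, hV2, rfl⟩, ⟨⟨?_, ?_, ?_⟩, ?_⟩⟩
  · rintro _ ⟨L, hL, rfl⟩
    have : finrank K (L.restrictScalars K) = finrank K F * finrank F L :=
      (finrank_mul_finrank K F L).symm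
    rw [this, hL, h3, hV]
  · rw [← range_lineOfSlope Ψ]
    rintro _ ⟨s, rfl⟩ v hv w hw
    obtain ⟨x, y, rfl⟩ := exists_eq_map Ψ v
    obtain ⟨x', y', rfl⟩ := exists_eq_map Ψ w
    rw [hΨ]
    rcases s with _ | a
    · rw [mem_lineOfSlope_none] at hv hw
      simp [hv, hw]
    · rw [mem_lineOfSlope_some] at hv hw
      subst hv hw
      rw [← map_zero (Algebra.trace K F)]
      congr 1
      ring
  · rw [← range_lineOfSlope Ψ]
    rintro _ ⟨s, rfl⟩ _ ⟨t, rfl⟩ hne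
    by_contra h
    obtain ⟨v, hv, hv0⟩ := Submodule.exists_mem_ne_zero_of_ne_bot h
    exact hne (congrArg _ (eq_of_mem_lineOfSlope Ψ hv0 hv.1 hv.2))
  · intro v
    obtain ⟨s, hs⟩ := exists_mem_lineOfSlope (K := K) Ψ v
    exact ⟨_, lineOfSlope_mem_extensionLines Ψ s, hs⟩

theorem mainTheorem10 {q : ℕ} (hq : IsPrimePow q)
    {K : Type u} [Field K] (hK : Nat.card K = q)
    {V : Type v} [AddCommGroup V] [Module K V] (hV : Module.finrank K V = 6)
    (B : LinearMap.BilinForm K V) (hAlt : B.IsAlt) (hB : B.Nondegenerate) :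
    (∃ S : Set (Submodule K V),
      IsMaximalSymplecticPartialSpread B S ∧ S.ncard = q ^ 3 - q ^ 2 + 1) ∧
    (∃ S : Set (Submodule K V), IsDesarguesianSpread S ∧ IsSymplecticSpread B S) ∧
    (∀ S : Set (Submodule K V), IsDesarguesianSpread S → IsSymplecticSpread B S →
      ∀ X ∈ S,
        (∃ U : Submodule K V, IsTotallyIsotropic B U ∧ Module.finrank K U = 3 ∧
          Module.finrank K (U ⊓ X : Submodule K V) = 2) ∧
        ∀ U : Submodule K V, IsTotallyIsotropic B U → Module.finrank K U = 3 →
          Module.finrank K (U ⊓ X : Submodule K V) = 2 →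
          (membersMeeting S U).ncard = q ^ 2 + 1 ∧
          IsMaximalSymplecticPartialSpread B (replaceBy S U) ∧
          (replaceBy S U).ncard = q ^ 3 - q ^ 2 + 1) := by
  have : Finite K := Nat.finite_of_card_ne_zero (hK ▸ hq.ne_zero)
  have hex := exists_isDesarguesianSpread_isSymplecticSpread hV B hAlt hB
  have hall : ∀ S : Set (Submodule K V), IsDesarguesianSpread S → IsSymplecticSpread B S →
      ∀ X ∈ S,
        (∃ U : Submodule K V, IsTotallyIsotropic B U ∧ Module.finrank K U = 3 ∧
          Module.finrank K (U ⊓ X : Submodule K V) = 2) ∧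
        ∀ U : Submodule K V, IsTotallyIsotropic B U → Module.finrank K U = 3 →
          Module.finrank K (U ⊓ X : Submodule K V) = 2 →
          (membersMeeting S U).ncard = q ^ 2 + 1 ∧
          IsMaximalSymplecticPartialSpread B (replaceBy S U) ∧
          (replaceBy S U).ncard = q ^ 3 - q ^ 2 + 1 := by
    rintro S ⟨F, _, _, _, _, hV2, hSF⟩ hS X hX
    obtain rfl : S = extensionLines K F V := hSF
    have h3 : finrank K F = 3 := by
      have := finrank_mul_finrank K F V
      rw [hV, hV2] at this
      omega
    have : FiniteDimensional K F := .of_finrank_pos (by omega)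
    have : Finite F := Module.finite_of_finite K
    refine ⟨exists_isTotallyIsotropic_finrank_inf_eq_two h3 hV2 hAlt hB hS hX, ?_⟩
    intro U hU hU3 hUX
    obtain ⟨Φ, A, hA, rfl, rfl⟩ := exists_eq_subspaceOfSlopes hV2 hX hU3 hUX
    have hA0 : A ≠ ⊥ := by
      rintro rfl
      simp at hA
    have hcA : Nat.card A = q ^ 2 := by rw [Module.natCard_eq_pow_finrank (K := K), hA, hK]
    have hcF : Nat.card F = q ^ 3 := by rw [Module.natCard_eq_pow_finrank (K := K), h3, hK]
    refine ⟨?_, isMaximalSymplecticPartialSpread_replaceBy h3 hV2 hS Φ hA hU, ?_⟩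
    · rw [ncard_membersMeeting_extensionLines Φ hA0, hcA]
    · rw [ncard_replaceBy_extensionLines hV2 Φ hA0
        (subspaceOfSlopes_notMem_extensionLines Φ hA), hcA, hcF]
  refine ⟨?_, hex, hall⟩
  obtain ⟨S, hSd, hS⟩ := hex
  -- Covering the zero vector only serves to show that `S` is nonempty.
  obtain ⟨X, hX, -⟩ := hS.cover 0
  obtain ⟨⟨U, hU, hU3, hUX⟩, h⟩ := hall S hSd hS X hX
  exact ⟨_, (h U hU hU3 hUX).2⟩
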